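/- Let $X$ be a nonempty Hausdorff topological space, let $\mathcal S=(f_i)_{i=1}^k$ be an iterated function system (IFS), i.e. finitely many continuous maps $f_i:X\to X$, and let $\rho=(\rho_i)_{i=1}^k$ be an admissible system of grey level maps: each $\rho_i:[0,1]\to[0,1]$ is nondecreasing and right continuous with $\rho_i(0)=0$, and $\rho_j(1)=1$ for some $j$. The pair $\mathcal S_{\mathcal F}=(\mathcal S,\rho)$ is a fuzzy IFS. Notation. $\mathcal K(X)$ is the family of nonempty compact subsets of $X$ and $\mathcal S(D)=\bigcup_i f_i(D)$. For a fuzzy set $u:X\to[0,1]$ put $[u]^\alpha=\{u\ge\alpha\}$ for $\alpha\in(0,1]$ and $[u]^0=\overline{\{u>0\}}$. $\mathcal K_{\mathcal F}(X)$ is the set of upper semicontinuous $u:X\to[0,1]$ that attain the value $1$ and have compact $[u]^0$. For $f:A\to B$ and $u:A\to[0,1]$, the Zadeh image is $f[u](y)=\sup\{u(x):f(x)=y\}$ (with $\sup\emptyset=0$). The fuzzy Hutchinson operator on $\mathcal K_{\mathcal F}(X)$ is $\mathcal S_{\mathcal F}(u)=\max_i \rho_i\circ f_i[u]$. $\mathcal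 S$ is compactly dominating if every $K\in\mathcal K(X)$ is contained in some $D\in\mathcal K(X)$ with $\mathcal S(D)\subset D$. It is topologically contracting if moreover, for every $D\in\mathcal K(X)$ with $\mathcal S(D)\subset D$ and every $\sigma\in\Sigma_k=\{1,\dots,k\}^{\mathbb N}$, the set $\bigcap_{n\ge1}f_{\sigma_1}\circ\dots\circ f_{\sigma_n}(D)$ is a singleton; it then does not depend on $D$, and its unique element is denoted $\pi(\sigma)$. Finally let $u_\Lambda:\Sigma_k\to[0,1]$, $u_\Lambda(\sigma)=\lim_{n\to\infty}\rho_{\sigma_1}\circ\dots\circ\rho_{\sigma_n}(1)$. A weak fuzzy attractor of $\mathcal S_{\mathcal F}$ is $u_*\in\mathcal K_{\mathcal F}(X)$ with $\mathcal S_{\mathcal F}(u_*)=u_*$ and $\mathcal S_{\mathcal F}^{(n)}(v)\to u_*$ for all $v\in\mathcal K_{\mathcal F}(X)$ in the $h$-topology, i.e. the topology induced by $u\mapsto\{(x,\alpha):x\in[u]^0,\ 0\le\alpha\le u(x)\}$ from the Vietoris topology on $\mathcal K(X\times[0,1])$. A multimetric on $X$ is a family $\mathcal D$ of pseudometrics such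 that any two distinct points are at positive distance for some $d\in\mathcal D$; $\mathcal T_{\mathcal D}$ is the topology whose basic neighbourhoods are the finite intersections of balls of members of $\mathcal D$; $\mathcal D$ is directed if every nonempty finite subfamily is dominated pointwise by a member of $\mathcal D$. $\mathcal S$ is Edelstein contracting with respect to $\mathcal D$ if for all $d\in\mathcal D$, all $i$ and all $x,y$: $d(f_i(x),f_i(y))\le d(x,y)$, with strict inequality when $d(x,y)>0$. A fuzzy attractor of $\mathcal S_{\mathcal F}$ on $(X,\mathcal D)$, where $\mathcal T_{\mathcal D}$ is the topology of $X$, is $u_*\in\mathcal K_{\mathcal F}(X)$ with $\mathcal S_{\mathcal F}(u_*)=u_*$ and $\mathcal S_{\mathcal F}^{(n)}(v)\to u_*$ for all $v\in\mathcal K_{\mathcal F}(X)$ in the topology generated by the pseudometrics $d_{HF}(u,v)=\sup_{\alpha\in[0,1]}d_H([u]^\alpha,[v]^\alpha)$, $d\in\mathcal D'$, for any directed multimetric $\mathcal D'$ with $\mathcal T_{\mathcal D'}=\mathcal T_{\mathcal D}$, where $d_H$ is the Hausdorff pseudometric of $d$. Theorem. (1) If $\mathcal S$ is topologically contracting, then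 $\mathcal S_{\mathcal F}$ has a weak fuzzy attractor, and its weak fuzzy attractor is $u_*=\pi[u_\Lambda]$. (2) If $\mathcal D$ is a multimetric on $X$ that generates the topology of $X$, and $\mathcal S$ is compactly dominating and Edelstein contracting with respect to $\mathcal D$, then $\mathcal S$ is topologically contracting (so that $\pi$ is defined), $\mathcal S_{\mathcal F}$ has a fuzzy attractor on $(X,\mathcal D)$, and its fuzzy attractor is $u_*=\pi[u_\Lambda]$. -/

import Mathlib

open Set Filter Topology TopologicalSpace unitInterval

/-- The prefix composition `g (ω 0) ∘ ⋯ ∘ g (ω (n - 1))` along a code `ω`. -/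
def prefixComp {k : ℕ} {α : Type*} (g : Fin k → α → α) (ω : ℕ → Fin k) : ℕ → α → α
  | 0 => id
  | n + 1 => prefixComp g ω n ∘ g (ω n)

/-! ### Iterated function systems -/

/-- An iterated function system: finitely many continuous selfmaps. -/
structure IFS (k : ℕ) (X : Type*) [TopologicalSpace X] where
  map : Fin k → X → X
  continuous_map : ∀ i, Continuous (map i)

namespace IFS

variable {k : ℕ} {X : Type*} [TopologicalSpace X]

/-- The Hutchinson operator `K ↦ ⋃ i, f i (K)` on sets. -/
def hutchinson (S : IFS k X) (K : Set X) : Set X := ⋃ i, S.map i '' K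

/-- Every nonempty compact set lies in a nonempty compact set `D` with `S(D) ⊆ D`. -/
def CompactlyDominating (S : IFS k X) : Prop :=
  ∀ K : Set X, K.Nonempty → IsCompact K →
    ∃ D : Set X, D.Nonempty ∧ IsCompact D ∧ K ⊆ D ∧ S.hutchinson D ⊆ D

/-- The fibre `⋂_{n ≥ 1} f_{ω₁} ∘ ⋯ ∘ f_{ωₙ} (D)`. -/
def fibre (S : IFS k X) (D : Set X) (ω : ℕ → Fin k) : Set X :=
  ⋂ n : ℕ, prefixComp S.map ω (n + 1) '' D

/-- Topological contractivity: compact dominancy, and all fibres over nonempty compact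
subinvariant sets are singletons. -/
def TopologicallyContracting (S : IFS k X) : Prop :=
  S.CompactlyDominating ∧
    ∀ D : Set X, D.Nonempty → IsCompact D → S.hutchinson D ⊆ D →
      ∀ ω : ℕ → Fin k, ∃ x, S.fibre D ω = {x}

/-- The projection map `π : Σ_k → X`: `π(ω)` is the point `x` such that the fibre over `ω` is `{x}`
for every nonempty compact `D` with `S(D) ⊆ D`. -/
noncomputable def proj [Nonempty X] (S : IFS k X) (ω : ℕ → Fin k) : X :=
  Classical.epsilon fun x =>
    ∀ D : Set X, D.Nonempty → IsCompact D → S.hutchinson D ⊆ D → S.fibre D ω = {x}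

/-- For a topologically contracting system the projection is well defined: the fibres do not
depend on the choice of `D`. -/
theorem TopologicallyContracting.fibre_eq [Nonempty X] {S : IFS k X}
    (h : S.TopologicallyContracting) (ω : ℕ → Fin k) {D : Set X} (hne : D.Nonempty)
    (hc : IsCompact D) (hD : S.hutchinson D ⊆ D) : S.fibre D ω = {S.proj ω} := by
  have mono : ∀ A B : Set X, A ⊆ B → S.fibre A ω ⊆ S.fibre B ω := fun A B hAB =>
    iInter_mono fun n => image_mono hAB
  have key : ∃ x, ∀ D : Set X, D.Nonempty → IsCompact D → S.hutchinson D ⊆ D →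
      S.fibre D ω = {x} := by
    obtain ⟨x, hx⟩ := h.2 D hne hc hD ω
    refine ⟨x, fun E hEne hEc hE => ?_⟩
    obtain ⟨F, hFne, hFc, hF, hFF⟩ := h.1 (D ∪ E) (hne.mono subset_union_left) (hc.union hEc)
    obtain ⟨y, hy⟩ := h.2 E hEne hEc hE ω
    obtain ⟨z, hz⟩ := h.2 F hFne hFc hFF ω
    have h1 := mono D F (subset_union_left.trans hF)
    have h2 := mono E F (subset_union_right.trans hF)
    rw [hx, hz, singleton_subset_singleton] at h1
    rw [hy, hz, singleton_subset_singleton] at h2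
    rw [hy, h1, h2]
  exact Classical.epsilon_spec key D hne hc hD

end IFS

/-! ### Compact fuzzy sets -/

/-- The Zadeh image of a fuzzy set, `f[u](y) = sup {u(x) : f(x) = y}`;
the supremum in `[0,1]` of the empty set is `0`. -/
noncomputable def zadehImage {A B : Type*} (f : A → B) (u : A → I) (y : B) : I :=
  sSup (u '' (f ⁻¹' {y}))

/-- The `α`-cut of a fuzzy set; the `0`-cut is the closed support. -/
noncomputable def fuzzyCut {X : Type*} [TopologicalSpace X] (u : X → I) (α : I) : Set X :=
  open Classical in if α = 0 then closure {x | 0 < u x} else {x | α ≤ u x}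

/-- The space `K_F(X)` of compact fuzzy sets. -/
@[ext]
structure CompactFuzzySet (X : Type*) [TopologicalSpace X] where
  toFun : X → I
  normal : ∃ x, toFun x = 1
  usc : UpperSemicontinuous toFun
  compact_support : IsCompact (fuzzyCut toFun 0)

namespace CompactFuzzySet

variable {X : Type*} [TopologicalSpace X]

theorem mem_cut_zero (u : X → I) {x : X} (h : 0 < u x) : x ∈ fuzzyCut u 0 := by
  simpa [fuzzyCut] using subset_closure (show x ∈ {x | 0 < u x} from h)

/-- The hypograph `{(x, α) : x ∈ [u]⁰, 0 ≤ α ≤ u(x)}`. -/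
def hypo (u : CompactFuzzySet X) : Set (X × I) :=
  {p | p.1 ∈ fuzzyCut u.toFun 0 ∧ p.2 ≤ u.toFun p.1}

theorem isCompact_hypo (u : CompactFuzzySet X) : IsCompact u.hypo := by
  have hcl : IsClosed {p : X × I | p.2 ≤ u.toFun p.1} := by
    rw [← isOpen_compl_iff, isOpen_iff_mem_nhds]
    rintro ⟨x, a⟩ hx
    have hx : u.toFun x < a := not_le.mp hx
    obtain ⟨b, hb1, hb2⟩ := exists_between hx
    have h1 : ∀ᶠ y in 𝓝 x, u.toFun y < b := u.usc x b hb1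
    have h2 : ∀ᶠ t in 𝓝 a, b < t := lt_mem_nhds hb2
    filter_upwards [h1.prod_nhds h2] with p hp
    exact not_le.mpr (hp.1.trans hp.2)
  have h := (u.compact_support.prod (isCompact_univ (X := I))).inter_right hcl
  convert h using 1
  ext p
  simp [hypo]

theorem hypo_nonempty (u : CompactFuzzySet X) : u.hypo.Nonempty := by
  obtain ⟨x, hx⟩ := u.normal
  exact ⟨(x, 0), mem_cut_zero _ (by rw [hx]; exact zero_lt_one), zero_le⟩

/-- The hypograph as an element of the hyperspace of nonempty compact sets. -/
def hypoCompacts (u : CompactFuzzySet X) : NonemptyCompacts (X × I) :=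
  ⟨⟨u.hypo, u.isCompact_hypo⟩, u.hypo_nonempty⟩

/-- The `h`-topology on `K_F(X)`: the topology induced by `u ↦ hypo(u)` from the Vietoris
topology on the nonempty compact subsets of `X × [0,1]`. -/
abbrev hTopology (X : Type*) [TopologicalSpace X] : TopologicalSpace (CompactFuzzySet X) :=
  TopologicalSpace.induced hypoCompacts inferInstance

end CompactFuzzySet

/-! ### Fuzzy iterated function systems -/

/-- A fuzzy iterated function system: an IFS together with an admissible system of grey level
maps. -/
structure FuzzyIFS (k : ℕ) (X : Type*) [TopologicalSpace X] extends IFS k X where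
  grey : Fin k → I → I
  grey_mono : ∀ i, Monotone (grey i)
  grey_right_cont : ∀ i t, ContinuousWithinAt (grey i) (Ici t) t
  grey_zero : ∀ i, grey i 0 = 0
  grey_one : ∃ j, grey j 1 = 1

namespace FuzzyIFS

variable {k : ℕ} {X : Type*} [TopologicalSpace X]

/-- The fuzzy set `max_i ρ_i ∘ (f_i[u])`. -/
noncomputable def hutchinsonFun (F : FuzzyIFS k X) (u : X → I) (x : X) : I :=
  Finset.univ.sup fun i => F.grey i (zadehImage (F.map i) u x)

theorem isClosed_grey_cut (F : FuzzyIFS k X) (i : Fin k) {u : X → I}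
    (hu : UpperSemicontinuous u) (α : I) :
    IsClosed {x | α ≤ F.grey i (u x)} := by
  rcases eq_empty_or_nonempty {t | α ≤ F.grey i t} with h | h
  · convert isClosed_empty (X := X)
    ext x
    simpa using fun hx => (h ▸ (show u x ∈ {t | α ≤ F.grey i t} from hx) : u x ∈ (∅ : Set I))
  · have hmem : α ≤ F.grey i (sInf {t | α ≤ F.grey i t}) := by
      by_contra! hlt
      set s := sInf {t | α ≤ F.grey i t} with hs
      have hev : ∀ᶠ t in 𝓝[≥] s, F.grey i t < α := (F.grey_right_cont i s).eventually_lt_const hlt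
      have hG : IsGLB {t | α ≤ F.grey i t} s := isGLB_sInf _
      have hfr : ∃ᶠ t in 𝓝[≥] s, t ∈ {t | α ≤ F.grey i t} := hG.frequently_mem h
      obtain ⟨t, ht1, ht2⟩ := (hfr.and_eventually hev).exists
      exact absurd ht1 (not_le.mpr ht2)
    have : {x | α ≤ F.grey i (u x)} = u ⁻¹' Ici (sInf {t | α ≤ F.grey i t}) := by
      ext x
      exact ⟨fun hx => sInf_le (show u x ∈ {t | α ≤ F.grey i t} from hx), fun hx => hmem.trans (F.grey_mono i hx)⟩
    rw [this]
    exact upperSemicontinuous_iff_isClosed_preimage.mp hu _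

theorem le_grey_zadehImage_iff [T2Space X] (F : FuzzyIFS k X) (i : Fin k)
    (u : CompactFuzzySet X) {α : I} (hα : 0 < α) (x : X) :
    α ≤ F.grey i (zadehImage (F.map i) u.toFun x) ↔ ∃ y, F.map i y = x ∧ α ≤ F.grey i (u.toFun y) := by
  constructor
  · intro h
    let K := fuzzyCut u.toFun 0 ∩ F.map i ⁻¹' {x}
    have hK : IsCompact K :=
      u.compact_support.inter_right (isClosed_singleton.preimage (F.continuous_map i))
    rcases K.eq_empty_or_nonempty with hE | hE
    · have h0 : zadehImage (F.map i) u.toFun x ≤ 0 := by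
        refine sSup_le ?_
        rintro _ ⟨y, hy, rfl⟩
        by_contra! hpos
        exact (hE ▸ (show y ∈ K from ⟨CompactFuzzySet.mem_cut_zero _ hpos, hy⟩) :
          y ∈ (∅ : Set X))
      have h1 := h.trans (F.grey_mono i h0)
      rw [F.grey_zero] at h1
      exact absurd h1 (not_le.mpr hα)
    · obtain ⟨y, hyK, hy⟩ := (u.usc.upperSemicontinuousOn K).exists_isMaxOn hE hK
      refine ⟨y, hyK.2, h.trans (F.grey_mono i (sSup_le ?_))⟩
      rintro _ ⟨z, hz, rfl⟩
      rcases (zero_le : (0 : I) ≤ u.toFun z).eq_or_lt with h0 | h0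
      · rw [← h0]; exact zero_le
      · exact hy (show z ∈ K from ⟨CompactFuzzySet.mem_cut_zero _ h0, hz⟩)
  · rintro ⟨y, hy, h⟩
    exact h.trans (F.grey_mono i (le_sSup ⟨y, hy, rfl⟩))

theorem hutchinsonFun_cut [T2Space X] (F : FuzzyIFS k X) (u : CompactFuzzySet X) {α : I}
    (hα : 0 < α) : {x | α ≤ F.hutchinsonFun u.toFun x} =
      ⋃ i, F.map i '' {y | α ≤ F.grey i (u.toFun y)} := by
  ext x
  have h := Finset.le_sup_iff (s := Finset.univ)
    (f := fun i => F.grey i (zadehImage (F.map i) u.toFun x)) (a := α) hα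
  simp only [mem_ofPred, mem_iUnion, mem_image, hutchinsonFun]
  rw [h]
  simp only [Finset.mem_univ, true_and, F.le_grey_zadehImage_iff _ u hα]
  exact exists_congr fun i => exists_congr fun y => and_comm

theorem grey_cut_subset (F : FuzzyIFS k X) (i : Fin k) (u : X → I) {α : I} (hα : 0 < α) :
    {y | α ≤ F.grey i (u y)} ⊆ fuzzyCut u 0 := by
  intro y hy
  refine CompactFuzzySet.mem_cut_zero _ (pos_iff_ne_zero.mpr fun h0 => ?_)
  rw [mem_ofPred, h0, F.grey_zero] at hy
  exact absurd hy (not_le.mpr hα)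

/-- The fuzzy Hutchinson operator `u ↦ max_i ρ_i ∘ (f_i[u])` on `K_F(X)`. -/
noncomputable def fuzzyHutchinson [T2Space X] (F : FuzzyIFS k X) (u : CompactFuzzySet X) :
    CompactFuzzySet X where
  toFun := F.hutchinsonFun u.toFun
  normal := by
    obtain ⟨j, hj⟩ := F.grey_one
    obtain ⟨x, hx⟩ := u.normal
    refine ⟨F.map j x, le_antisymm le_one' ?_⟩
    have : F.map j x ∈ {x | (1 : I) ≤ F.hutchinsonFun u.toFun x} := by
      rw [F.hutchinsonFun_cut u zero_lt_one]
      exact mem_iUnion.mpr ⟨j, x, by simp [hx, hj], rfl⟩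
    exact this
  usc := by
    rw [upperSemicontinuous_iff_isClosed_preimage]
    intro α
    rcases (zero_le : (0 : I) ≤ α).eq_or_lt with h | h
    · convert isClosed_univ (X := X)
      ext x
      simp [← h]
    · change IsClosed {x | α ≤ F.hutchinsonFun u.toFun x}
      rw [F.hutchinsonFun_cut u h]
      refine isClosed_iUnion_of_finite fun i => IsCompact.isClosed (IsCompact.image ?_
        (F.continuous_map i))
      exact u.compact_support.of_isClosed_subset (F.isClosed_grey_cut i u.usc α)
        (F.grey_cut_subset i _ h)
  compact_support := by
    have hc : IsCompact (⋃ i, F.map i '' fuzzyCut u.toFun 0) :=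
      isCompact_iUnion fun i => u.compact_support.image (F.continuous_map i)
    simp only [fuzzyCut, if_true]
    refine hc.closure_of_subset fun x (hx : 0 < F.hutchinsonFun u.toFun x) => ?_
    have hx' : x ∈ {z | F.hutchinsonFun u.toFun x ≤ F.hutchinsonFun u.toFun z} :=
      le_refl (F.hutchinsonFun u.toFun x)
    rw [F.hutchinsonFun_cut u hx] at hx'
    obtain ⟨i, y, hy, rfl⟩ := mem_iUnion.mp hx'
    exact mem_iUnion.mpr ⟨i, y, F.grey_cut_subset i _ hx hy, rfl⟩

/-- A weak fuzzy attractor: a fixed point of the fuzzy Hutchinson operator to which all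
iterations converge in the `h`-topology. -/
def IsWeakFuzzyAttractor [T2Space X] (F : FuzzyIFS k X) (u : CompactFuzzySet X) : Prop :=
  F.fuzzyHutchinson u = u ∧
    ∀ v : CompactFuzzySet X, Tendsto (fun n : ℕ => F.fuzzyHutchinson^[n] v) atTop
      (@nhds _ (CompactFuzzySet.hTopology X) u)

/-- The fuzzy set `u_Λ(ω) = lim_n ρ_{ω₁} ∘ ⋯ ∘ ρ_{ωₙ}(1)` on the code space. -/
noncomputable def uLambda (F : FuzzyIFS k X) (ω : ℕ → Fin k) : I :=
  @limUnder _ _ _ ⟨0⟩ atTop fun n : ℕ => prefixComp F.grey ω n 1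

/-- The limit defining `u_Λ` always exists. -/
theorem tendsto_uLambda (F : FuzzyIFS k X) (ω : ℕ → Fin k) :
    Tendsto (fun n : ℕ => prefixComp F.grey ω n 1) atTop (𝓝 (F.uLambda ω)) := by
  have hm : ∀ n, Monotone (prefixComp F.grey ω n) := by
    intro n
    induction n with
    | zero => exact monotone_id
    | succ n ih => exact ih.comp (F.grey_mono _)
  have ha : Antitone fun n : ℕ => prefixComp F.grey ω n 1 :=
    antitone_nat_of_succ_le fun n => hm n le_one'
  exact tendsto_nhds_limUnder ⟨_, tendsto_atTop_iInf ha⟩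

end FuzzyIFS

/-! ### Multimetric spaces -/

/-- A (real-valued) pseudometric. -/
structure IsPseudometric {X : Type*} (d : X → X → ℝ) : Prop where
  self : ∀ x, d x x = 0
  symm : ∀ x y, d x y = d y x
  triangle : ∀ x y z, d x y ≤ d x z + d z y

/-- A multimetric: a family of pseudometrics that separates points. -/
structure IsMultimetric {X : Type*} (𝒟 : Set (X → X → ℝ)) : Prop where
  pseudo : ∀ d ∈ 𝒟, IsPseudometric d
  separating : ∀ x y, x ≠ y → ∃ d ∈ 𝒟, 0 < d x y

/-- Every nonempty finite subfamily is dominated by a member of the family. -/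
def IsDirectedFamily {X : Type*} (𝒟 : Set (X → X → ℝ)) : Prop :=
  ∀ 𝒢 : Set (X → X → ℝ), 𝒢 ⊆ 𝒟 → 𝒢.Finite → 𝒢.Nonempty →
    ∃ d ∈ 𝒟, ∀ g ∈ 𝒢, ∀ x y, g x y ≤ d x y

/-- The topology generated by a family of pseudometrics: `U` is open iff around each of its points
it contains a ball `⋂_{d ∈ 𝒢} B_d(x, ε)` with `𝒢 ⊆ 𝒟` finite and `ε > 0`. -/
abbrev multiTopology {X : Type*} (𝒟 : Set (X → X → ℝ)) : TopologicalSpace X where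
  IsOpen U := ∀ x ∈ U, ∃ ε > 0, ∃ 𝒢 : Set (X → X → ℝ), 𝒢 ⊆ 𝒟 ∧ 𝒢.Finite ∧
    {y | ∀ d ∈ 𝒢, d x y < ε} ⊆ U
  isOpen_univ := fun _ _ => ⟨1, one_pos, ∅, empty_subset _, finite_empty, subset_univ _⟩
  isOpen_inter := by
    rintro U V hU hV x ⟨hxU, hxV⟩
    obtain ⟨ε, hε, 𝒢, h1, h2, h3⟩ := hU x hxU
    obtain ⟨δ, hδ, ℋ, h4, h5, h6⟩ := hV x hxV
    refine ⟨min ε δ, lt_min hε hδ, 𝒢 ∪ ℋ, union_subset h1 h4, h2.union h5, fun y hy => ⟨?_, ?_⟩⟩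
    · exact h3 fun d hd => (hy d (Or.inl hd)).trans_le (min_le_left _ _)
    · exact h6 fun d hd => (hy d (Or.inr hd)).trans_le (min_le_right _ _)
  isOpen_sUnion := by
    rintro s hs x ⟨U, hU, hx⟩
    obtain ⟨ε, hε, 𝒢, h1, h2, h3⟩ := hs U hU x hx
    exact ⟨ε, hε, 𝒢, h1, h2, h3.trans (subset_sUnion_of_mem hU)⟩

/-- The Hausdorff pseudometric `max {sup_{x ∈ K} inf_{y ∈ D} d(x,y), sup_{y ∈ D} inf_{x ∈ K} d(x,y)}`
on nonempty compact sets. -/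
noncomputable def hausdorffPM {X : Type*} (d : X → X → ℝ) (K D : Set X) : ℝ :=
  max (sSup ((fun x => sInf (d x '' D)) '' K)) (sSup ((fun y => sInf ((fun x => d x y) '' K)) '' D))

/-- The pseudometric `d_HF(u,v) = sup_{α ∈ [0,1]} d_H([u]^α, [v]^α)` on `K_F(X)`. -/
noncomputable def fuzzyPM {X : Type*} [TopologicalSpace X] (d : X → X → ℝ)
    (u v : CompactFuzzySet X) : ℝ :=
  sSup (range fun α : I => hausdorffPM d (fuzzyCut u.toFun α) (fuzzyCut v.toFun α))

/-- Edelstein contractivity of an IFS with respect to a family of pseudometrics. -/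
def IFS.EdelsteinContracting {k : ℕ} {X : Type*} [TopologicalSpace X] (S : IFS k X)
    (𝒟 : Set (X → X → ℝ)) : Prop :=
  ∀ d ∈ 𝒟, ∀ i, (∀ x y, d (S.map i x) (S.map i y) ≤ d x y) ∧
    ∀ x y, 0 < d x y → d (S.map i x) (S.map i y) < d x y

/-- A fuzzy attractor on a multimetric space `(X, 𝒟)`: a fixed point of the fuzzy Hutchinson
operator to which all iterations converge in the canonical topology on `K_F(X)`, that is, the
topology generated by `{d_HF : d ∈ 𝒟'}` where `𝒟'` is any directed multimetric generating the same
topology on `X` as `𝒟`. -/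
def FuzzyIFS.IsFuzzyAttractor {k : ℕ} {X : Type*} [TopologicalSpace X] [T2Space X]
    (F : FuzzyIFS k X) (𝒟 : Set (X → X → ℝ)) (u : CompactFuzzySet X) : Prop :=
  F.fuzzyHutchinson u = u ∧
    ∀ 𝒟' : Set (X → X → ℝ), IsMultimetric 𝒟' → IsDirectedFamily 𝒟' →
      multiTopology 𝒟' = multiTopology 𝒟 →
      ∀ v : CompactFuzzySet X, Tendsto (fun n : ℕ => F.fuzzyHutchinson^[n] v) atTop
        (@nhds _ (multiTopology (fuzzyPM '' 𝒟')) u)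

/-! ### Words, codes and compositions along prefixes. -/

section Codes

variable {k : ℕ} {α : Type*}

/-! Fix a compact subinvariant `D`. For `u` supported in `D`, a positive level at `x` in the `n`-th
iterate comes from a word `w` of length `n`: `x` lies in the piece `f_w(D)`, and the level is at
most `ρ_w(1)`. A normal `v` supported in `D` realises at least the level `ρ_w(1)` somewhere in the
same piece. So the cuts of the `n`-th iterates of `u` and `v` differ, at every level simultaneously,
by at most the size of a piece (`exists_common_piece`).

Topological contraction and compactness of the code space make long pieces finer than any open cover
(`exists_forall_image_prod_subset`). The combination, `eventually_cut_close`, gives uniqueness of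
fixed points and both kinds of convergence, each from its own cover. It remains to find one fixed
point: `π[u_Λ]` is one because `π` and `u_Λ` are both compatible with the shift (`map_proj`,
`uLambda_shift`).

In the Edelstein case, compactness yields a uniform decrease of distances that stay large, which
forces the fibres to be singletons. -/

theorem prefixComp_congr (g : Fin k → α → α) {ω τ : ℕ → Fin k} :
    ∀ {n : ℕ}, (∀ m < n, ω m = τ m) → prefixComp g ω n = prefixComp g τ n
  | 0, _ => rfl
  | n + 1, h => by
    rw [prefixComp, prefixComp, prefixComp_congr g fun m hm => h m (hm.trans n.lt_succ_self),
      h n n.lt_succ_self]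

/-- Splitting off the outermost map of a prefix composition. -/
theorem prefixComp_succ_left (g : Fin k → α → α) (ω : ℕ → Fin k) :
    ∀ n : ℕ, prefixComp g ω (n + 1) = g (ω 0) ∘ prefixComp g (fun m => ω (m + 1)) n
  | 0 => rfl
  | n + 1 => by
    rw [prefixComp, prefixComp_succ_left g ω n, Function.comp_assoc, ← prefixComp]

theorem prefixComp_monotone [Preorder α] {g : Fin k → α → α} (hg : ∀ i, Monotone (g i))
    (ω : ℕ → Fin k) : ∀ n : ℕ, Monotone (prefixComp g ω n)
  | 0 => monotone_id
  | n + 1 => (prefixComp_monotone hg ω n).comp (hg _)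

theorem prefixComp_fixed {g : Fin k → α → α} {ω : ℕ → Fin k} {a : α} (h : ∀ m, g (ω m) a = a) :
    ∀ n : ℕ, prefixComp g ω n a = a
  | 0 => rfl
  | n + 1 => by rw [prefixComp, Function.comp_apply, h, prefixComp_fixed h n]

/-- Needed for `0`-cuts: a union of pieces of a given length is a finite union, hence closed. -/
theorem finite_range_prefixComp (g : Fin k → α → α) :
    ∀ n : ℕ, (range fun ω : ℕ → Fin k => prefixComp g ω n).Finite
  | 0 => (finite_singleton id).subset (range_subset_iff.mpr fun _ => rfl)
  | n + 1 => ((finite_range_prefixComp g n).image2 (· ∘ ·) (finite_range g)).subset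
      (range_subset_iff.mpr fun ω => ⟨_, ⟨ω, rfl⟩, _, ⟨ω n, rfl⟩, rfl⟩)

/-- The code obtained by prepending a letter. -/
def codeCons (i : Fin k) (ω : ℕ → Fin k) : ℕ → Fin k
  | 0 => i
  | n + 1 => ω n

theorem prefixComp_codeCons (g : Fin k → α → α) (i : Fin k) (ω : ℕ → Fin k) (n : ℕ) :
    prefixComp g (codeCons i ω) (n + 1) = g i ∘ prefixComp g ω n :=
  prefixComp_succ_left g (codeCons i ω) n

theorem eventually_forall_lt_eq (ω : ℕ → Fin k) (n : ℕ) :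
    ∀ᶠ τ in 𝓝 ω, ∀ m < n, τ m = ω m := by
  have h : ∀ m ∈ Finset.range n, ∀ᶠ τ in 𝓝 ω, τ m = ω m := fun m _ =>
    (continuous_apply m).continuousAt.eventually (mem_nhds_discrete.mpr rfl : {ω m} ∈ 𝓝 (ω m))
  have h2 := (Filter.eventually_all_finset (Finset.range n)).mpr h
  exact h2.mono fun τ hτ m hm => hτ m (Finset.mem_range.mpr hm)

end Codes

/-! ### Pieces of a subinvariant set and the projection `π`. -/

namespace IFS

variable {k : ℕ} {X : Type*} [TopologicalSpace X]

theorem continuous_prefixComp (S : IFS k X) (ω : ℕ → Fin k) :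
    ∀ n : ℕ, Continuous (prefixComp S.map ω n)
  | 0 => continuous_id
  | n + 1 => (S.continuous_prefixComp ω n).comp (S.continuous_map _)

theorem map_mem_of_hutchinson_subset {S : IFS k X} {D : Set X} (hD : S.hutchinson D ⊆ D)
    (i : Fin k) {x : X} (hx : x ∈ D) : S.map i x ∈ D :=
  hD (mem_iUnion.mpr ⟨i, x, hx, rfl⟩)

theorem antitone_image_prefixComp {S : IFS k X} {D : Set X} (hD : S.hutchinson D ⊆ D)
    (ω : ℕ → Fin k) : Antitone fun n => prefixComp S.map ω n '' D := by
  refine antitone_nat_of_succ_le fun n => ?_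
  rintro _ ⟨x, hx, rfl⟩
  exact ⟨_, map_mem_of_hutchinson_subset hD _ hx, rfl⟩

theorem prefixComp_mem {S : IFS k X} {D : Set X} (hD : S.hutchinson D ⊆ D)
    (ω : ℕ → Fin k) (n : ℕ) {x : X} (hx : x ∈ D) : prefixComp S.map ω n x ∈ D := by
  obtain ⟨y, hy, h⟩ := antitone_image_prefixComp hD ω n.zero_le (mem_image_of_mem _ hx)
  exact h ▸ hy

namespace TopologicallyContracting

variable [Nonempty X] {S : IFS k X} {D : Set X}

theorem proj_mem (h : S.TopologicallyContracting) (hne : D.Nonempty) (hc : IsCompact D)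
    (hD : S.hutchinson D ⊆ D) (ω : ℕ → Fin k) (n : ℕ) :
    S.proj ω ∈ prefixComp S.map ω n '' D := by
  have h1 : S.proj ω ∈ S.fibre D ω := by rw [h.fibre_eq ω hne hc hD]; rfl
  exact antitone_image_prefixComp hD ω n.le_succ (mem_iInter.mp h1 n)

theorem exists_subinvariant (h : S.TopologicallyContracting) :
    ∃ D : Set X, D.Nonempty ∧ IsCompact D ∧ S.hutchinson D ⊆ D := by
  obtain ⟨x⟩ := ‹Nonempty X›
  obtain ⟨D, h1, h2, -, h3⟩ := h.1 {x} (singleton_nonempty x) isCompact_singleton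
  exact ⟨D, h1, h2, h3⟩

/-- The outermost map carries the `n`-th piece of the shifted code onto the `(n + 1)`-th piece of
`ω`, so the left side lies in the fibre over `ω`. -/
theorem map_proj (h : S.TopologicallyContracting) (ω : ℕ → Fin k) :
    S.map (ω 0) (S.proj fun m => ω (m + 1)) = S.proj ω := by
  obtain ⟨D, hne, hc, hD⟩ := h.exists_subinvariant
  have : S.map (ω 0) (S.proj fun m => ω (m + 1)) ∈ S.fibre D ω := by
    refine mem_iInter.mpr fun n => ?_
    rw [prefixComp_succ_left, image_comp]
    exact mem_image_of_mem _ (h.proj_mem hne hc hD _ n)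
  rwa [h.fibre_eq ω hne hc hD] at this

/-- Nested compact sets shrinking to a point eventually enter each of its neighbourhoods. -/
theorem exists_image_subset [T2Space X] (h : S.TopologicallyContracting) (hne : D.Nonempty)
    (hc : IsCompact D) (hD : S.hutchinson D ⊆ D) (ω : ℕ → Fin k) {U : Set X}
    (hU : U ∈ 𝓝 (S.proj ω)) : ∃ n : ℕ, ∀ m ≥ n, prefixComp S.map ω m '' D ⊆ U := by
  have hcpt : ∀ n : ℕ, IsCompact (prefixComp S.map ω (n + 1) '' D) := fun n =>
    hc.image (S.continuous_prefixComp ω _)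
  have hanti := antitone_image_prefixComp hD ω
  obtain ⟨n, hn⟩ := exists_subset_nhds_of_isCompact'
    (V := fun n : ℕ => prefixComp S.map ω (n + 1) '' D) (U := U)
    (directed_of_isDirected_le fun a b hab => hanti (Nat.succ_le_succ hab)) hcpt
    (fun n => (hcpt n).isClosed) (by
      intro x hx
      have hx' : x ∈ S.fibre D ω := hx
      rw [h.fibre_eq ω hne hc hD] at hx'
      rwa [mem_singleton_iff.mp hx'])
  exact ⟨n + 1, fun m hm => (hanti hm).trans hn⟩

theorem continuous_proj [T2Space X] (h : S.TopologicallyContracting) : Continuous S.proj := by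
  obtain ⟨D, hne, hc, hD⟩ := h.exists_subinvariant
  refine continuous_iff_continuousAt.mpr fun ω U hU => ?_
  obtain ⟨n, hn⟩ := h.exists_image_subset hne hc hD ω hU
  change ∀ᶠ τ in 𝓝 ω, S.proj τ ∈ U
  filter_upwards [eventually_forall_lt_eq ω n] with τ hτ
  refine hn n le_rfl ?_
  rw [← prefixComp_congr S.map hτ]
  exact h.proj_mem hne hc hD τ n

/-- Lebesgue number lemma for long prefix compositions: for every open cover of `X × Y`, `Y`
compact, all sufficiently fine pieces `f_{ω₁} ∘ ⋯ ∘ f_{ωₙ} (D) × {a}` lie in a member. -/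
theorem exists_forall_image_prod_subset [T2Space X] {Y ι : Type*} [TopologicalSpace Y]
    [CompactSpace Y] (h : S.TopologicallyContracting) (hne : D.Nonempty)
    (hc : IsCompact D) (hD : S.hutchinson D ⊆ D) {U : ι → Set (X × Y)}
    (hU : ∀ i, IsOpen (U i)) (hcover : ∀ p, ∃ i, p ∈ U i) :
    ∃ N : ℕ, ∀ n ≥ N, ∀ ω a, ∃ i, ∀ x ∈ prefixComp S.map ω n '' D, (x, a) ∈ U i := by
  have key : ∃ N : ℕ, ∀ n ≥ N, ∀ p ∈ (univ : Set ((ℕ → Fin k) × Y)),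
      ∃ i, ∀ x ∈ prefixComp S.map p.1 n '' D, (x, p.2) ∈ U i := by
    refine isCompact_univ.induction_on
      (p := fun s : Set ((ℕ → Fin k) × Y) => ∃ N : ℕ, ∀ n ≥ N, ∀ p ∈ s,
        ∃ i, ∀ x ∈ prefixComp S.map p.1 n '' D, (x, p.2) ∈ U i) ?_ ?_ ?_ ?_
    · exact ⟨0, fun n _ p hp => hp.elim⟩
    · rintro s t hst ⟨N, hN⟩
      exact ⟨N, fun n hn p hp => hN n hn p (hst hp)⟩
    · rintro s t ⟨N, hN⟩ ⟨M, hM⟩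
      refine ⟨max N M, fun n hn p hp => hp.elim (hN n (le_trans (le_max_left _ _) hn) p)
        (hM n (le_trans (le_max_right _ _) hn) p)⟩
    · rintro ⟨ω, a⟩ -
      obtain ⟨i, hi⟩ := hcover (S.proj ω, a)
      obtain ⟨V, W, hV, haV, hW, haW, hVW⟩ := mem_nhds_prod_iff'.mp ((hU i).mem_nhds hi)
      obtain ⟨N, hN⟩ := h.exists_image_subset hne hc hD ω (hV.mem_nhds haV)
      -- All codes in this neighbourhood share their first `N` letters with `ω`, so their pieces of
      -- length `n ≥ N` lie in one piece of `ω`.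
      refine ⟨_, mem_nhdsWithin_of_mem_nhds
        (prod_mem_nhds (eventually_forall_lt_eq ω N) (hW.mem_nhds haW)), N, ?_⟩
      rintro n hn ⟨τ, b⟩ ⟨hτ, hb⟩
      refine ⟨i, fun x hx => hVW ⟨hN N le_rfl ?_, hb⟩⟩
      rw [← prefixComp_congr S.map hτ]
      exact antitone_image_prefixComp hD τ hn hx
  obtain ⟨N, hN⟩ := key
  exact ⟨N, fun n hn ω a => hN n hn (ω, a) trivial⟩

end TopologicallyContracting

end IFS

/-! ### Cuts and hypographs. -/

theorem mem_fuzzyCut_iff {X : Type*} [TopologicalSpace X] {u : X → I} {α : I} (hα : 0 < α) {x : X} :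
    x ∈ fuzzyCut u α ↔ α ≤ u x := by
  simp [fuzzyCut, hα.ne']

theorem fuzzyCut_zero {X : Type*} [TopologicalSpace X] (u : X → I) :
    fuzzyCut u 0 = closure {x | 0 < u x} := by
  simp [fuzzyCut]

theorem mem_fuzzyCut_of_le {X : Type*} [TopologicalSpace X] {u : X → I} {α : I} {x : X}
    (h0 : 0 < u x) (h : α ≤ u x) : x ∈ fuzzyCut u α := by
  rcases (zero_le : (0 : I) ≤ α).eq_or_lt with rfl | hα
  · exact CompactFuzzySet.mem_cut_zero u h0
  · exact (mem_fuzzyCut_iff hα).mpr h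

theorem CompactFuzzySet.mem_hypo_iff {X : Type*} [TopologicalSpace X] {u : CompactFuzzySet X}
    {x : X} {a : I} : (x, a) ∈ u.hypo ↔ x ∈ fuzzyCut u.toFun a := by
  constructor
  · rintro ⟨h1, h2⟩
    rcases (zero_le : (0 : I) ≤ a).eq_or_lt with rfl | ha
    · exact h1
    · exact (mem_fuzzyCut_iff ha).mpr h2
  · intro h
    rcases (zero_le : (0 : I) ≤ a).eq_or_lt with rfl | ha
    · exact ⟨h, zero_le⟩
    · rw [mem_fuzzyCut_iff ha] at h
      exact ⟨CompactFuzzySet.mem_cut_zero _ (ha.trans_le h), h⟩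

namespace FuzzyIFS

variable {k : ℕ} {X : Type*} [TopologicalSpace X]

theorem le_hutchinsonFun_iff [T2Space X] (F : FuzzyIFS k X) (u : CompactFuzzySet X) {α : I} (hα : 0 < α)
    (x : X) : α ≤ F.hutchinsonFun u.toFun x ↔
      ∃ i y, F.map i y = x ∧ α ≤ F.grey i (u.toFun y) := by
  have := Set.ext_iff.mp (F.hutchinsonFun_cut u hα) x
  simp only [mem_iUnion, mem_image] at this
  exact this.trans (exists_congr fun i => exists_congr fun y => and_comm)

theorem pos_of_grey_pos (F : FuzzyIFS k X) {i : Fin k} {t : I} (h : 0 < F.grey i t) : 0 < t := by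
  refine pos_iff_ne_zero.mpr fun h0 => h.ne' ?_
  rw [h0, F.grey_zero]

/-! ### The fuzzy set `u_Λ` on the code space. -/

section CodeSpace

variable (F : FuzzyIFS k X)

theorem uLambda_le (ω : ℕ → Fin k) (n : ℕ) : F.uLambda ω ≤ prefixComp F.grey ω n 1 := by
  have ha : Antitone fun n : ℕ => prefixComp F.grey ω n 1 :=
    antitone_nat_of_succ_le fun n => prefixComp_monotone F.grey_mono ω n le_one'
  exact ha.le_of_tendsto (F.tendsto_uLambda ω) n

/-- The approximations of `u_Λ` decrease to their limit, so right continuity suffices to pass `ρ`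
through it. -/
theorem uLambda_shift (ω : ℕ → Fin k) :
    F.uLambda ω = F.grey (ω 0) (F.uLambda fun m => ω (m + 1)) := by
  set τ : ℕ → Fin k := fun m => ω (m + 1)
  have h1 : Tendsto (fun n : ℕ => prefixComp F.grey τ n 1) atTop (𝓝[≥] F.uLambda τ) :=
    tendsto_nhdsWithin_iff.mpr ⟨F.tendsto_uLambda τ, Eventually.of_forall (F.uLambda_le τ)⟩
  have h2 := (F.grey_right_cont (ω 0) (F.uLambda τ)).tendsto.comp h1
  have h3 := (F.tendsto_uLambda ω).comp (tendsto_add_atTop_nat 1)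
  refine tendsto_nhds_unique h3 (h2.congr fun n => ?_)
  simp only [Function.comp_apply, prefixComp_succ_left, τ]

/-- `u_Λ` is an infimum of functions each depending on finitely many letters. -/
theorem upperSemicontinuous_uLambda : UpperSemicontinuous F.uLambda := by
  intro ω b hb
  obtain ⟨n, hn⟩ := ((F.tendsto_uLambda ω).eventually_lt_const hb).exists
  filter_upwards [eventually_forall_lt_eq ω n] with τ hτ
  refine (F.uLambda_le τ n).trans_lt ?_
  rwa [prefixComp_congr F.grey hτ]

theorem exists_uLambda_eq_one : ∃ ω, F.uLambda ω = 1 := by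
  obtain ⟨j, hj⟩ := F.grey_one
  refine ⟨fun _ => j, tendsto_nhds_unique (F.tendsto_uLambda _) ?_⟩
  simp only [prefixComp_fixed (g := F.grey) (ω := fun _ => j) (a := 1) fun _ => hj]
  exact tendsto_const_nhds

end CodeSpace

/-! ### The fixed point `π[u_Λ]`. -/

section Attractor

variable [T2Space X] [Nonempty X] {F : FuzzyIFS k X}

/-- The supremum is attained: `u_Λ` is upper semicontinuous and fibres of `π` are compact.
Positivity of `α` excludes the empty fibre, where the supremum is `0`. -/
theorem le_zadehImage_proj_iff (h : F.toIFS.TopologicallyContracting) {α : I} (hα : 0 < α)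
    (x : X) : α ≤ zadehImage F.toIFS.proj F.uLambda x ↔
      ∃ ω, F.toIFS.proj ω = x ∧ α ≤ F.uLambda ω := by
  refine ⟨fun hx => ?_, fun ⟨ω, hω, hle⟩ => hle.trans (le_sSup ⟨ω, hω, rfl⟩)⟩
  have hK : IsCompact (F.toIFS.proj ⁻¹' {x}) :=
    (isClosed_singleton.preimage h.continuous_proj).isCompact
  rcases (F.toIFS.proj ⁻¹' {x}).eq_empty_or_nonempty with hE | hE
  · rw [zadehImage, hE, image_empty, sSup_empty] at hx
    exact absurd hx (not_le.mpr hα)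
  · obtain ⟨ω, hω, hmax⟩ :=
      (F.upperSemicontinuous_uLambda.upperSemicontinuousOn _).exists_isMaxOn hE hK
    refine ⟨ω, hω, hx.trans (sSup_le ?_)⟩
    rintro _ ⟨τ, hτ, rfl⟩
    exact hmax hτ

/-- The fuzzy set `π[u_Λ]` as a compact fuzzy set. -/
noncomputable def attractor (h : F.toIFS.TopologicallyContracting) : CompactFuzzySet X where
  toFun := zadehImage F.toIFS.proj F.uLambda
  normal := by
    obtain ⟨ω, hω⟩ := F.exists_uLambda_eq_one
    exact ⟨F.toIFS.proj ω, le_antisymm le_one'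
      ((le_zadehImage_proj_iff h zero_lt_one _).mpr ⟨ω, rfl, hω.ge⟩)⟩
  usc := by
    rw [upperSemicontinuous_iff_isClosed_preimage]
    intro α
    rcases (zero_le : (0 : I) ≤ α).eq_or_lt with rfl | hα
    · convert isClosed_univ (X := X)
      exact eq_univ_of_forall fun x => (zero_le : (0 : I) ≤ _)
    · have : zadehImage F.toIFS.proj F.uLambda ⁻¹' Ici α =
          F.toIFS.proj '' (F.uLambda ⁻¹' Ici α) := by
        ext x
        exact (le_zadehImage_proj_iff h hα x).trans (exists_congr fun ω => and_comm)
      rw [this]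
      exact ((upperSemicontinuous_iff_isClosed_preimage.mp
        F.upperSemicontinuous_uLambda α).isCompact.image h.continuous_proj).isClosed
  compact_support := by
    rw [fuzzyCut_zero]
    refine (isCompact_range h.continuous_proj).closure_of_subset fun x hx => ?_
    obtain ⟨ω, hω, -⟩ := (le_zadehImage_proj_iff h hx x).mp le_rfl
    exact ⟨ω, hω⟩

theorem fuzzyHutchinson_attractor (h : F.toIFS.TopologicallyContracting) :
    F.fuzzyHutchinson (attractor h) = attractor h := by
  have key : ∀ {α : I}, 0 < α → ∀ x,
      α ≤ F.hutchinsonFun (attractor h).toFun x ↔ α ≤ (attractor h).toFun x := by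
    intro α hα x
    rw [F.le_hutchinsonFun_iff _ hα]
    refine Iff.trans ?_ (le_zadehImage_proj_iff h hα x).symm
    constructor
    · rintro ⟨i, y, rfl, hy⟩
      -- Taken at the level of `y` itself rather than `α`, so that `ω` attains the value to which
      -- the grey map is applied.
      obtain ⟨ω, rfl, hω⟩ := (le_zadehImage_proj_iff h
        (F.pos_of_grey_pos (hα.trans_le hy)) y).mp le_rfl
      refine ⟨codeCons i ω, (h.map_proj (codeCons i ω)).symm, ?_⟩
      rw [F.uLambda_shift]
      exact hy.trans (F.grey_mono i hω)
    · rintro ⟨ω, rfl, hω⟩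
      refine ⟨ω 0, _, h.map_proj ω, ?_⟩
      rw [F.uLambda_shift] at hω
      exact hω.trans (F.grey_mono _ (le_sSup ⟨_, rfl, rfl⟩))
  ext x : 2
  refine le_antisymm ?_ ?_
  · by_cases hx : 0 < F.hutchinsonFun (attractor h).toFun x
    · exact (key hx x).mp le_rfl
    · exact (not_lt.mp hx).trans zero_le
  · by_cases hx : 0 < (attractor h).toFun x
    · exact (key hx x).mpr le_rfl
    · exact (not_lt.mp hx).trans zero_le

end Attractor

/-! ### Cuts of the iterates. -/

section Iterates

variable [T2Space X] (F : FuzzyIFS k X)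

/-- With `exists_of_le_iterate` this describes the iterate as a maximum over words of length `n` and
preimages. -/
theorem prefixComp_grey_le_iterate (u : CompactFuzzySet X) (n : ℕ) :
    ∀ (ω : ℕ → Fin k) (y : X), prefixComp F.grey ω n (u.toFun y) ≤
      (F.fuzzyHutchinson^[n] u).toFun (prefixComp F.map ω n y) := by
  induction n with
  | zero => exact fun _ _ => le_rfl
  | succ n ih =>
    intro ω y
    rcases (zero_le : (0 : I) ≤ prefixComp F.grey ω (n + 1) (u.toFun y)).eq_or_lt with h | h
    · rw [← h]; exact zero_le
    rw [Function.iterate_succ_apply']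
    refine (F.le_hutchinsonFun_iff _ h _).mpr ⟨ω 0, prefixComp F.map (fun m => ω (m + 1)) n y, ?_, ?_⟩
    · rw [prefixComp_succ_left]; rfl
    · rw [prefixComp_succ_left]
      exact F.grey_mono _ (ih _ y)

theorem exists_of_le_iterate (u : CompactFuzzySet X) (n : ℕ) :
    ∀ {α : I} {x : X}, 0 < α → α ≤ (F.fuzzyHutchinson^[n] u).toFun x →
      ∃ ω y, prefixComp F.map ω n y = x ∧ α ≤ prefixComp F.grey ω n (u.toFun y) := by
  induction n with
  | zero =>
    intro α x _ h
    obtain ⟨j, -⟩ := F.grey_one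
    exact ⟨fun _ => j, x, rfl, h⟩
  | succ n ih =>
    intro α x hα h
    rw [Function.iterate_succ_apply'] at h
    obtain ⟨i, y, rfl, hy⟩ := (F.le_hutchinsonFun_iff _ hα _).mp h
    obtain ⟨ω, z, rfl, hz⟩ := ih (F.pos_of_grey_pos (hα.trans_le hy)) le_rfl
    refine ⟨codeCons i ω, z, by rw [prefixComp_codeCons]; rfl, ?_⟩
    rw [prefixComp_codeCons]
    exact hy.trans (F.grey_mono i hz)

/-- A point of a cut of the `n`-th iterate of `u` lies in a piece `f_{ω₁} ∘ ⋯ ∘ f_{ωₙ} (D)` that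
also meets the corresponding cut of the `n`-th iterate of any other `v` supported in `D`. -/
theorem exists_common_piece {D : Set X} (hc : IsCompact D) (u v : CompactFuzzySet X)
    (hu : fuzzyCut u.toFun 0 ⊆ D) (hv : fuzzyCut v.toFun 0 ⊆ D) (n : ℕ) {α : I} {x : X}
    (hx : x ∈ fuzzyCut (F.fuzzyHutchinson^[n] u).toFun α) :
    ∃ ω, x ∈ prefixComp F.map ω n '' D ∧
      ∃ z ∈ prefixComp F.map ω n '' D, z ∈ fuzzyCut (F.fuzzyHutchinson^[n] v).toFun α := by
  have hpiece : ∀ {β : I} {x : X}, 0 < β → β ≤ (F.fuzzyHutchinson^[n] u).toFun x →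
      ∃ ω, x ∈ prefixComp F.map ω n '' D ∧ 0 < prefixComp F.grey ω n 1 ∧
        β ≤ prefixComp F.grey ω n 1 := by
    intro β x hβ hx
    obtain ⟨ω, y, rfl, hy⟩ := F.exists_of_le_iterate u n hβ hx
    have h1 : β ≤ prefixComp F.grey ω n 1 :=
      hy.trans (prefixComp_monotone F.grey_mono ω n le_one')
    refine ⟨ω, mem_image_of_mem _ (hu (CompactFuzzySet.mem_cut_zero _ ?_)), hβ.trans_le h1, h1⟩
    refine pos_iff_ne_zero.mpr fun h0 => ?_
    rw [h0, prefixComp_fixed fun m => F.grey_zero _] at hy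
    exact absurd hy (not_le.mpr hβ)
  have hmain : ∃ ω, x ∈ prefixComp F.map ω n '' D ∧ 0 < prefixComp F.grey ω n 1 ∧
      α ≤ prefixComp F.grey ω n 1 := by
    -- For `α = 0` the cut is a closure; the finite union of pieces of positive weight is closed and
    -- contains the support, hence also its closure.
    rcases (zero_le : (0 : I) ≤ α).eq_or_lt with rfl | hα
    · let T : Set (Set X) :=
        {s | ∃ ω, 0 < prefixComp F.grey ω n 1 ∧ prefixComp F.map ω n '' D = s}
      have hfin : T.Finite := ((finite_range_prefixComp F.map n).image (· '' D)).subset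
        fun s ⟨ω, _, hs⟩ => ⟨_, ⟨ω, rfl⟩, hs⟩
      have hclosed : IsClosed (⋃₀ T) := by
        rw [sUnion_eq_biUnion]
        exact hfin.isClosed_biUnion fun s ⟨ω, _, hs⟩ =>
          hs ▸ (hc.image (F.toIFS.continuous_prefixComp ω n)).isClosed
      rw [fuzzyCut_zero] at hx
      obtain ⟨_, ⟨ω, h0, rfl⟩, hxω⟩ := closure_minimal (t := ⋃₀ T) (fun y hy => by
        obtain ⟨ω, h1, h2, -⟩ := hpiece hy le_rfl
        exact ⟨_, ⟨ω, h2, rfl⟩, h1⟩) hclosed hx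
      exact ⟨ω, hxω, h0, zero_le⟩
    · exact hpiece hα ((mem_fuzzyCut_iff hα).mp hx)
  obtain ⟨ω, hxω, h0, hα⟩ := hmain
  -- Where `v` equals `1`, the image under the word has at least the full weight of the word, which
  -- dominates `α` and is positive.
  obtain ⟨y, hy⟩ := v.normal
  have hle := F.prefixComp_grey_le_iterate v n ω y
  rw [hy] at hle
  exact ⟨ω, hxω, _, mem_image_of_mem _ (hv (CompactFuzzySet.mem_cut_zero _ (by simp [hy]))),
    mem_fuzzyCut_of_le (h0.trans_le hle) (hα.trans hle)⟩

end Iterates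

end FuzzyIFS

/-! ### Pseudometrics and the Hausdorff distance. -/

section Pseudometric

variable {X : Type*}

theorem IsPseudometric.nonneg {d : X → X → ℝ} (h : IsPseudometric d) (x y : X) : 0 ≤ d x y := by
  have h1 := h.triangle x x y
  rw [h.self, h.symm y x] at h1
  linarith

theorem isOpen_ball_of_mem [t : TopologicalSpace X] {𝒟 : Set (X → X → ℝ)}
    (hT : multiTopology 𝒟 = t) {d : X → X → ℝ} (hd : d ∈ 𝒟) (hp : IsPseudometric d) (x : X)
    (ε : ℝ) : IsOpen {y | d x y < ε} := by
  subst hT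
  intro y hy
  refine ⟨ε - d x y, sub_pos.mpr hy, {d}, singleton_subset_iff.mpr hd, finite_singleton d, ?_⟩
  intro z hz
  have h1 : d y z < ε - d x y := hz d rfl
  have h2 := hp.triangle x z y
  change d x z < ε
  linarith

theorem continuous_pseudometric_of_mem [t : TopologicalSpace X] {𝒟 : Set (X → X → ℝ)}
    (hT : multiTopology 𝒟 = t) {d : X → X → ℝ} (hd : d ∈ 𝒟) (hp : IsPseudometric d) :
    Continuous fun p : X × X => d p.1 p.2 := by
  refine continuous_iff_continuousAt.mpr fun p => Metric.tendsto_nhds.mpr fun ε hε => ?_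
  have hball : ∀ x, ∀ᶠ y in 𝓝 x, d x y < ε / 2 := fun x =>
    (isOpen_ball_of_mem hT hd hp x _).mem_nhds (by simpa [hp.self] using half_pos hε)
  filter_upwards [(hball p.1).prod_nhds (hball p.2)] with q hq
  have h1 := hp.triangle q.1 q.2 p.1
  have h2 := hp.triangle p.1 q.2 p.2
  have h3 := hp.triangle p.1 p.2 q.1
  have h4 := hp.triangle q.1 p.2 q.2
  have h5 := hp.symm p.1 q.1
  have h6 := hp.symm p.2 q.2
  rw [Real.dist_eq, abs_lt]
  constructor <;> linarith [hq.1, hq.2]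

theorem hausdorffPM_le {d : X → X → ℝ} (hp : IsPseudometric d) {K D : Set X} (hK : K.Nonempty)
    (hD : D.Nonempty) {r : ℝ} (h1 : ∀ x ∈ K, ∃ y ∈ D, d x y ≤ r)
    (h2 : ∀ y ∈ D, ∃ x ∈ K, d x y ≤ r) : hausdorffPM d K D ≤ r := by
  refine max_le (csSup_le (hK.image _) ?_) (csSup_le (hD.image _) ?_)
  · rintro _ ⟨x, hx, rfl⟩
    obtain ⟨y, hy, hxy⟩ := h1 x hx
    refine (csInf_le ⟨0, ?_⟩ (mem_image_of_mem _ hy)).trans hxy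
    rintro _ ⟨z, -, rfl⟩
    exact hp.nonneg x z
  · rintro _ ⟨y, hy, rfl⟩
    obtain ⟨x, hx, hxy⟩ := h2 y hy
    refine (csInf_le ⟨0, ?_⟩ (mem_image_of_mem _ hx)).trans hxy
    rintro _ ⟨z, -, rfl⟩
    exact hp.nonneg z y

end Pseudometric

theorem CompactFuzzySet.cut_nonempty {X : Type*} [TopologicalSpace X] (u : CompactFuzzySet X)
    (α : I) : (fuzzyCut u.toFun α).Nonempty := by
  obtain ⟨x, hx⟩ := u.normal
  exact ⟨x, mem_fuzzyCut_of_le (by simp [hx]) (by rw [hx]; exact le_one')⟩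

theorem CompactFuzzySet.isClosed_cut {X : Type*} [TopologicalSpace X] (u : CompactFuzzySet X)
    (α : I) : IsClosed (fuzzyCut u.toFun α) := by
  rcases (zero_le : (0 : I) ≤ α).eq_or_lt with rfl | hα
  · rw [fuzzyCut_zero]; exact isClosed_closure
  · have : fuzzyCut u.toFun α = u.toFun ⁻¹' Ici α := by
      ext x; exact mem_fuzzyCut_iff hα
    rw [this]
    exact upperSemicontinuous_iff_isClosed_preimage.mp u.usc α

/-! ### Uniqueness and convergence. -/

namespace FuzzyIFS

variable {k : ℕ} {X : Type*} [TopologicalSpace X] [T2Space X] [Nonempty X] {F : FuzzyIFS k X}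

/-- A common piece of length `n` fits into one member of the cover once `n` is large. The cover
lives on `X × I` to accommodate hypographs. -/
theorem eventually_cut_close (h : F.toIFS.TopologicallyContracting) (u v : CompactFuzzySet X)
    {ι : Type*} {U : ι → Set (X × I)} (hU : ∀ i, IsOpen (U i)) (hcover : ∀ p, ∃ i, p ∈ U i) :
    ∀ᶠ n : ℕ in atTop, ∀ (a : I), ∀ x ∈ fuzzyCut (F.fuzzyHutchinson^[n] u).toFun a,
      ∃ z ∈ fuzzyCut (F.fuzzyHutchinson^[n] v).toFun a, ∃ i, (x, a) ∈ U i ∧ (z, a) ∈ U i := by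
  obtain ⟨D, hne, hc, hsub, hD⟩ := h.1 _ ((u.cut_nonempty 0).mono subset_union_left)
    (u.compact_support.union v.compact_support)
  obtain ⟨N, hN⟩ := h.exists_forall_image_prod_subset hne hc hD hU hcover
  filter_upwards [eventually_ge_atTop N] with n hn a x hx
  obtain ⟨ω, hxω, z, hzω, hz⟩ := F.exists_common_piece hc u v
    (subset_union_left.trans hsub) (subset_union_right.trans hsub) n hx
  obtain ⟨i, hi⟩ := hN n hn ω a
  exact ⟨z, hz, i, hi x hxω, hi z hzω⟩

theorem le_of_fixed (h : F.toIFS.TopologicallyContracting) {u v : CompactFuzzySet X}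
    (hu : F.fuzzyHutchinson u = u) (hv : F.fuzzyHutchinson v = v) (x : X) :
    u.toFun x ≤ v.toFun x := by
  rcases (zero_le : (0 : I) ≤ u.toFun x).eq_or_lt with h0 | h0
  · rw [← h0]; exact zero_le
  by_contra! hlt
  set α := u.toFun x with hα
  have hxv : x ∉ fuzzyCut v.toFun α := fun hx => absurd ((mem_fuzzyCut_iff h0).mp hx) hlt.not_ge
  -- The first set misses the `α`-cut of `v` and the second misses `x`, so no member can contain
  -- both `x` and a point of that cut.
  let U : Bool → Set (X × I) := fun b =>
    bif b then {p | p.1 ∈ (fuzzyCut v.toFun α)ᶜ} else {p | p.1 ∈ ({x} : Set X)ᶜ}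
  have hU : ∀ b, IsOpen (U b) := by
    rintro (_ | _)
    · exact isOpen_compl_singleton.preimage continuous_fst
    · exact (v.isClosed_cut α).isOpen_compl.preimage continuous_fst
  have hcover : ∀ p, ∃ b, p ∈ U b := by
    intro p
    by_cases hp : p.1 = x
    · exact ⟨true, show p.1 ∉ _ by rwa [hp]⟩
    · exact ⟨false, hp⟩
  obtain ⟨n, hn⟩ := (eventually_cut_close h u v hU hcover).exists
  rw [Function.iterate_fixed hu, Function.iterate_fixed hv] at hn
  obtain ⟨z, hz, b, hb1, hb2⟩ := hn α x ((mem_fuzzyCut_iff h0).mpr le_rfl)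
  cases b
  · exact hb1 rfl
  · exact hb2 hz

theorem eq_of_fixed (h : F.toIFS.TopologicallyContracting) {u v : CompactFuzzySet X}
    (hu : F.fuzzyHutchinson u = u) (hv : F.fuzzyHutchinson v = v) : u = v := by
  ext x : 2
  exact le_antisymm (le_of_fixed h hu hv x) (le_of_fixed h hv hu x)

theorem isWeakFuzzyAttractor_attractor (h : F.toIFS.TopologicallyContracting) :
    F.IsWeakFuzzyAttractor (attractor h) := by
  have hfix := fuzzyHutchinson_attractor h
  refine ⟨hfix, fun v => ?_⟩
  let _ := TopologicalSpace.vietoris (X × I)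
  rw [nhds_induced, tendsto_comap_iff, NonemptyCompacts.isEmbedding_coe.tendsto_nhds_iff]
  refine tendsto_nhds_generateFrom_iff.mpr ?_
  -- Subbasic Vietoris sets: compacta contained in `W`, and compacta meeting `W`.
  rintro _ (⟨W, hW : IsOpen W, rfl⟩ | ⟨W, hW : IsOpen W, rfl⟩) hmem
  · have hmem' : (attractor h).hypo ⊆ W := hmem
    -- The companion point lies in the hypograph of the attractor, so the shared member must be `W`.
    let U : Bool → Set (X × I) := fun b => bif b then W else (attractor h).hypoᶜ
    have hU : ∀ b, IsOpen (U b) := by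
      rintro (_ | _)
      · exact (attractor h).isCompact_hypo.isClosed.isOpen_compl
      · exact hW
    have hcover : ∀ p, ∃ b, p ∈ U b := by
      intro p
      by_cases hp : p ∈ (attractor h).hypo
      · exact ⟨true, hmem' hp⟩
      · exact ⟨false, hp⟩
    filter_upwards [eventually_cut_close h v (attractor h) hU hcover] with n hn
    rw [Function.iterate_fixed hfix] at hn
    rintro ⟨x, a⟩ hx
    obtain ⟨z, hz, b, hb1, hb2⟩ := hn a x (CompactFuzzySet.mem_hypo_iff.mp hx)
    cases b
    · exact absurd (CompactFuzzySet.mem_hypo_iff.mpr hz) hb2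
    · exact hb1
  · obtain ⟨⟨x, a⟩, hx, hxW⟩ : ((attractor h).hypo ∩ W).Nonempty := hmem
    -- A member containing `(x, a)` can only be `W`, which therefore also contains the companion
    -- point.
    let U : Bool → Set (X × I) := fun b => bif b then W else {(x, a)}ᶜ
    have hU : ∀ b, IsOpen (U b) := by
      rintro (_ | _)
      · exact isOpen_compl_singleton
      · exact hW
    have hcover : ∀ p, ∃ b, p ∈ U b := by
      intro p
      by_cases hp : p = (x, a)
      · exact ⟨true, hp ▸ hxW⟩
      · exact ⟨false, hp⟩
    filter_upwards [eventually_cut_close h (attractor h) v hU hcover] with n hn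
    rw [Function.iterate_fixed hfix] at hn
    obtain ⟨z, hz, b, hb1, hb2⟩ := hn a x (CompactFuzzySet.mem_hypo_iff.mp hx)
    cases b
    · exact absurd rfl hb1
    · exact ⟨(z, a), CompactFuzzySet.mem_hypo_iff.mpr hz, hb2⟩

theorem isFuzzyAttractor_attractor (h : F.toIFS.TopologicallyContracting)
    {𝒟 : Set (X → X → ℝ)} (hT : multiTopology 𝒟 = ‹TopologicalSpace X›) :
    F.IsFuzzyAttractor 𝒟 (attractor h) := by
  have hfix := fuzzyHutchinson_attractor h
  refine ⟨hfix, fun 𝒟' hM _ hT' v => ?_⟩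
  rw [hT] at hT'
  have hsmall : ∀ d ∈ 𝒟', ∀ ε > 0,
      ∀ᶠ n : ℕ in atTop, fuzzyPM d (attractor h) (F.fuzzyHutchinson^[n] v) < ε := by
    intro d hd ε hε
    have hp := hM.pseudo d hd
    -- Radius `ε / 4` gives distances at most `ε / 2`; the slack keeps the supremum over levels
    -- strictly below `ε`.
    let U : X → Set (X × I) := fun y => {p | d y p.1 < ε / 4}
    have hU : ∀ y, IsOpen (U y) := fun y =>
      (isOpen_ball_of_mem hT' hd hp y (ε / 4)).preimage continuous_fst
    have hcover : ∀ p, ∃ y, p ∈ U y := fun p =>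
      ⟨p.1, show d p.1 p.1 < ε / 4 by rw [hp.self]; positivity⟩
    have hdist : ∀ {x z y : X} {a : I}, (x, a) ∈ U y → (z, a) ∈ U y → d x z ≤ ε / 2 := by
      intro x z y a hx hz
      have h1 : d y x < ε / 4 := hx
      have h2 : d y z < ε / 4 := hz
      have h3 := hp.triangle x z y
      rw [hp.symm x y] at h3
      linarith
    filter_upwards [eventually_cut_close h (attractor h) v hU hcover,
      eventually_cut_close h v (attractor h) hU hcover] with n h1 h2
    rw [Function.iterate_fixed hfix] at h1 h2
    refine lt_of_le_of_lt (csSup_le (range_nonempty _) ?_) (half_lt_self hε)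
    rintro _ ⟨α, rfl⟩
    refine hausdorffPM_le hp (CompactFuzzySet.cut_nonempty _ _)
      (CompactFuzzySet.cut_nonempty _ _) ?_ ?_
    · intro x hx
      obtain ⟨z, hz, y, hy1, hy2⟩ := h1 α x hx
      exact ⟨z, hz, hdist hy1 hy2⟩
    · intro x hx
      obtain ⟨z, hz, y, hy1, hy2⟩ := h2 α x hx
      exact ⟨z, hz, hdist hy2 hy1⟩
  let _ := multiTopology (fuzzyPM '' 𝒟' : Set (CompactFuzzySet X → CompactFuzzySet X → ℝ))
  refine tendsto_nhds.mpr fun W hW hmem => ?_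
  obtain ⟨ε, hε, 𝒢, h𝒢, hfin, hsub⟩ := hW _ hmem
  have : ∀ᶠ n : ℕ in atTop, ∀ g ∈ 𝒢, g (attractor h) (F.fuzzyHutchinson^[n] v) < ε := by
    refine (Filter.eventually_all_finite hfin).mpr fun g hg => ?_
    obtain ⟨d, hd, rfl⟩ := h𝒢 hg
    exact hsmall d hd ε hε
  exact this.mono fun n hn => hsub hn

end FuzzyIFS

/-! ### Edelstein contractions are topologically contracting. -/

namespace IFS

variable {k : ℕ} {X : Type*} [TopologicalSpace X] {S : IFS k X}

/-- On a compact set, pairs that are at least `ε` apart are brought closer by a fixed amount. -/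
theorem exists_uniform_decrease {d : X → X → ℝ} (hd : Continuous fun p : X × X => d p.1 p.2)
    (hS : ∀ i x y, 0 < d x y → d (S.map i x) (S.map i y) < d x y) {D : Set X} (hc : IsCompact D)
    {ε : ℝ} (hε : 0 < ε) : ∃ c > 0, ∀ i, ∀ x ∈ D, ∀ y ∈ D, ε ≤ d x y →
      d (S.map i x) (S.map i y) ≤ d x y - c := by
  have hcpt : IsCompact ((univ : Set (Fin k)) ×ˢ ((D ×ˢ D) ∩ {p | ε ≤ d p.1 p.2})) :=
    isCompact_univ.prod ((hc.prod hc).inter_right (isClosed_le continuous_const hd))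
  have hcont : Continuous fun q : Fin k × (X × X) =>
      d q.2.1 q.2.2 - d (S.map q.1 q.2.1) (S.map q.1 q.2.2) := by
    refine continuous_prod_of_discrete_left.mpr fun i => hd.sub ?_
    exact hd.comp (((S.continuous_map i).comp continuous_fst).prodMk
      ((S.continuous_map i).comp continuous_snd))
  -- The decrease is continuous and positive on a compact set, hence bounded away from `0`.
  obtain ⟨c, hc0, hc1⟩ := hcpt.exists_forall_le' hcont.continuousOn (a := 0)
    fun q hq => sub_pos.mpr (hS q.1 _ _ (hε.trans_le hq.2.2))
  refine ⟨c, hc0, fun i x hx y hy hxy => ?_⟩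
  have := hc1 (i, (x, y)) ⟨trivial, ⟨hx, hy⟩, hxy⟩
  dsimp only at this
  linarith

/-- A distance once below `ε` stays there, since the maps do not expand; until then each map costs
at least `c`. -/
theorem prefixComp_dist_lt_or_le {d : X → X → ℝ} {D : Set X} (hD : S.hutchinson D ⊆ D)
    (hS : ∀ i x y, d (S.map i x) (S.map i y) ≤ d x y) {ε c M : ℝ}
    (hdec : ∀ i, ∀ x ∈ D, ∀ y ∈ D, ε ≤ d x y → d (S.map i x) (S.map i y) ≤ d x y - c)
    (hM : ∀ x ∈ D, ∀ y ∈ D, d x y ≤ M) (n : ℕ) :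
    ∀ ω : ℕ → Fin k, ∀ x ∈ D, ∀ y ∈ D,
      d (prefixComp S.map ω n x) (prefixComp S.map ω n y) < ε ∨
      d (prefixComp S.map ω n x) (prefixComp S.map ω n y) ≤ M - n * c := by
  induction n with
  | zero => exact fun _ x hx y hy => Or.inr (by simpa [prefixComp] using hM x hx y hy)
  | succ n ih =>
    intro ω x hx y hy
    rw [prefixComp_succ_left]
    set τ : ℕ → Fin k := fun m => ω (m + 1)
    rcases lt_or_ge (d (prefixComp S.map τ n x) (prefixComp S.map τ n y)) ε with h | h
    · exact Or.inl ((hS _ _ _).trans_lt h)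
    · right
      have h1 := (ih τ x hx y hy).resolve_left h.not_gt
      have h2 := hdec (ω 0) _ (prefixComp_mem hD τ n hx) _ (prefixComp_mem hD τ n hy) h
      simp only [Function.comp_apply]
      push_cast
      linarith

theorem EdelsteinContracting.topologicallyContracting [T2Space X] {𝒟 : Set (X → X → ℝ)}
    (h𝒟 : IsMultimetric 𝒟) (hT : multiTopology 𝒟 = ‹TopologicalSpace X›)
    (hS : S.EdelsteinContracting 𝒟) (hdom : S.CompactlyDominating) :
    S.TopologicallyContracting := by
  refine ⟨hdom, fun D hne hc hD ω => ?_⟩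
  have hcpt : ∀ n, IsCompact (prefixComp S.map ω n '' D) := fun n =>
    hc.image (S.continuous_prefixComp ω n)
  obtain ⟨x, hx⟩ : (S.fibre D ω).Nonempty :=
    IsCompact.nonempty_iInter_of_sequence_nonempty_isCompact_isClosed _
      (fun n => antitone_image_prefixComp hD ω (n + 1).le_succ) (fun n => hne.image _)
      (hcpt _) fun n => (hcpt _).isClosed
  refine ⟨x, eq_singleton_iff_unique_mem.mpr ⟨hx, fun y hy => ?_⟩⟩
  by_contra hxy
  obtain ⟨d, hd, hpos⟩ := h𝒟.separating y x hxy
  have hcont := continuous_pseudometric_of_mem hT hd (h𝒟.pseudo d hd)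
  -- The threshold is `d y x` itself: the first alternative then reads `d y x < d y x`, and for `n >
  -- M / c` the second makes `d y x` negative.
  obtain ⟨c, hc0, hdec⟩ := exists_uniform_decrease (S := S) hcont (fun i => (hS d hd i).2) hc hpos
  obtain ⟨M, hM⟩ := ((hc.prod hc).image hcont).bddAbove
  obtain ⟨n, hn⟩ := exists_nat_gt (M / c)
  obtain ⟨p, hp, hpx⟩ := mem_iInter.mp hx n
  obtain ⟨q, hq, hqy⟩ := mem_iInter.mp hy n
  rcases prefixComp_dist_lt_or_le hD (fun i => (hS d hd i).1) hdec
    (fun a ha b hb => hM ⟨(a, b), ⟨ha, hb⟩, rfl⟩) (n + 1) ω q hq p hp with h | h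
  · rw [hpx, hqy] at h
    exact lt_irrefl _ h
  · rw [hpx, hqy] at h
    rw [div_lt_iff₀ hc0] at hn
    push_cast at h
    linarith

end IFS

theorem mainTheorem7 {k : ℕ} {X : Type*} [TopologicalSpace X] [T2Space X] [Nonempty X]
    (F : FuzzyIFS k X) :
    (F.toIFS.TopologicallyContracting →
      (∃ u : CompactFuzzySet X, F.IsWeakFuzzyAttractor u) ∧
      ∀ u : CompactFuzzySet X, F.IsWeakFuzzyAttractor u →
        u.toFun = zadehImage F.toIFS.proj F.uLambda) ∧
    (∀ 𝒟 : Set (X → X → ℝ), IsMultimetric 𝒟 → multiTopology 𝒟 = ‹TopologicalSpace X› →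
      F.toIFS.CompactlyDominating → F.toIFS.EdelsteinContracting 𝒟 →
        F.toIFS.TopologicallyContracting ∧
        (∃ u : CompactFuzzySet X, F.IsFuzzyAttractor 𝒟 u) ∧
        ∀ u : CompactFuzzySet X, F.IsFuzzyAttractor 𝒟 u →
          u.toFun = zadehImage F.toIFS.proj F.uLambda) := by
  -- Being a fixed point already determines the fuzzy set, so one argument identifies both kinds of
  -- attractor.
  have huniq : ∀ (_ : F.toIFS.TopologicallyContracting) (u : CompactFuzzySet X),
      F.fuzzyHutchinson u = u → u.toFun = zadehImage F.toIFS.proj F.uLambda := fun h u hu =>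
    congrArg CompactFuzzySet.toFun
      (FuzzyIFS.eq_of_fixed h hu (FuzzyIFS.fuzzyHutchinson_attractor h))
  refine ⟨fun h => ⟨⟨_, FuzzyIFS.isWeakFuzzyAttractor_attractor h⟩, fun u hu => huniq h u hu.1⟩,
    fun 𝒟 h𝒟 hT hdom hS => ?_⟩
  have h := hS.topologicallyContracting h𝒟 hT hdom
  exact ⟨h, ⟨_, FuzzyIFS.isFuzzyAttractor_attractor h hT⟩, fun u hu => huniq h u hu.1⟩
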